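/- Let $n\in\mathbb N$ and let $\Omega\subset\mathbb R^n$ be a bounded, open, connected set with $C^1$ boundary $\Gamma=\partial\Omega$, that is, every $z\in\Gamma$ has an open neighbourhood $U$ and a function $\psi\in C^1(U)$ with $\Omega\cap U=\{y\in U:\psi(y)<0\}$ and $D\psi(z)\neq 0$; the outer unit normal at $z$ is $\nu(z)=D\psi(z)/|D\psi(z)|$. Let $\gamma:\Gamma\to\mathbb R^n$ be a continuous vector field that is oblique to $\Gamma$, i.e. $\nu(z)\cdot\gamma(z)>0$ for all $z\in\Gamma$. Let $x\in\overline\Omega$ and let $v:[0,\infty)\to\mathbb R^n$ be integrable on every bounded subinterval of $[0,\infty)$. Then there exist a function $\eta:[0,\infty)\to\mathbb R^n$ that is absolutely continuous on every bounded subinterval of $[0,\infty)$ and a function $l:[0,\infty)\to\mathbb R$ that is integrable on every bounded subinterval of $[0,\infty)$ such that $$\eta(0)=x,\qquad \eta(t)\in\overline\Omega\quad\text{for all } t\ge 0,$$ $$\dot\eta(t)+l(t)\,\gamma(\eta(t))=v(t)\quad\text{for a.e. } t\ge 0,$$ $$l(t)\ge 0\quad\text{and}\quad l(t)=0\ \text{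 if }\ \eta(t)\in\Omega,\qquad\text{for a.e. } t\ge 0,$$ where the product $l(t)\gamma(\eta(t))$ is understood to be $0$ when $\eta(t)\in\Omega$ and $l(t)=0$. -/

import Mathlib

open MeasureTheory Set

/-- `ψ` is a `C¹` defining function of `Ω` on the open neighbourhood `U` of the point `x`:
inside `U` the set `Ω` is exactly `{ψ < 0}`, and the gradient of `ψ` does not vanish at `x`. -/
structure IsC1DefiningFunction {n : ℕ} (Ω : Set (EuclideanSpace ℝ (Fin n)))
    (x : EuclideanSpace ℝ (Fin n)) (U : Set (EuclideanSpace ℝ (Fin n)))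
    (ψ : EuclideanSpace ℝ (Fin n) → ℝ) : Prop where
  isOpen : IsOpen U
  mem : x ∈ U
  contDiffOn : ContDiffOn ℝ 1 ψ U
  mem_iff : ∀ y ∈ U, (y ∈ Ω ↔ ψ y < 0)
  gradient_ne_zero : gradient ψ x ≠ 0

/-- The open set `Ω` has `C¹` boundary: near each boundary point it has a `C¹` defining function
(equivalently, up to a rotation, it is locally the strict subgraph of a `C¹` function). -/
def HasC1Boundary {n : ℕ} (Ω : Set (EuclideanSpace ℝ (Fin n))) : Prop :=
  ∀ x ∈ frontier Ω, ∃ U ψ, IsC1DefiningFunction Ω x U ψ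

/-- `ν` is the outer unit normal of `Ω` at the boundary point `x`, i.e. `∇ψ(x) / |∇ψ(x)|` for a
defining function `ψ` (this vector does not depend on the choice of `ψ`). -/
def IsOuterUnitNormal {n : ℕ} (Ω : Set (EuclideanSpace ℝ (Fin n)))
    (x ν : EuclideanSpace ℝ (Fin n)) : Prop :=
  x ∈ frontier Ω ∧
    ∃ U ψ, IsC1DefiningFunction Ω x U ψ ∧ ν = ‖gradient ψ x‖⁻¹ • gradient ψ x

/-- The vector field `γ` is oblique to the boundary of `Ω`: `ν(x) · γ(x) > 0` for every boundary
point `x`, where `ν(x)` is the outer unit normal. -/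
def IsOblique {n : ℕ} (Ω : Set (EuclideanSpace ℝ (Fin n)))
    (γ : EuclideanSpace ℝ (Fin n) → EuclideanSpace ℝ (Fin n)) : Prop :=
  ∀ x ∈ frontier Ω, ∀ ν, IsOuterUnitNormal Ω x ν → 0 < inner ℝ ν (γ x)

/-- `f`, restricted to `[0, ∞)`, is integrable on every bounded interval of `[0, ∞)`.
Values at negative times are irrelevant. -/
def MemL1Loc {F : Type*} [NormedAddCommGroup F] (f : ℝ → F) : Prop :=
  ∀ T : ℝ, IntegrableOn f (Icc 0 T) volume

/-- `f`, restricted to `[0, ∞)`, is absolutely continuous on every bounded interval of `[0, ∞)`.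
Values at negative times are irrelevant. -/
def MemACLoc {F : Type*} [NormedAddCommGroup F] (f : ℝ → F) : Prop :=
  ∀ T : ℝ, 0 ≤ T → AbsolutelyContinuousOnInterval f 0 T

/-- `(η, l)` solves the Skorokhod problem in the closure of `Ω` with reflection direction `γ`,
initial point `x` and driving velocity `v`. -/
structure IsSkorokhodSolution {n : ℕ} (Ω : Set (EuclideanSpace ℝ (Fin n)))
    (γ : EuclideanSpace ℝ (Fin n) → EuclideanSpace ℝ (Fin n))
    (x : EuclideanSpace ℝ (Fin n)) (v : ℝ → EuclideanSpace ℝ (Fin n))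
    (η : ℝ → EuclideanSpace ℝ (Fin n)) (l : ℝ → ℝ) : Prop where
  memACLoc : MemACLoc η
  memL1Loc : MemL1Loc l
  initial : η 0 = x
  mem_closure : ∀ t : ℝ, 0 ≤ t → η t ∈ closure Ω
  equation : ∀ᵐ t ∂volume.restrict (Ici (0 : ℝ)),
    DifferentiableAt ℝ η t ∧ deriv η t + l t • γ (η t) = v t
  reflection : ∀ᵐ t ∂volume.restrict (Ici (0 : ℝ)), 0 ≤ l t ∧ (η t ∈ Ω → l t = 0)

/-! With `P` and `W` the primitives of `v` and `‖v‖`, run an Euler scheme: over a grid interval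
where `W` grows by `m`, move by the increment of `P` and, if some boundary point `z` lies within
`m`, also push back by `C * m` times `γ z`. Obliqueness makes this push re-enter the closure
(`exists_uniform_correction`, by compactness of the boundary).

The schemes are controlled by `W`, and over short times their deviation from `P` lies in `ΔW • Q`
for any convex `Q` containing `0` and the nearby values `C • γ z`. Both facts survive the limit
(`exists_euler_limit`). Differentiating gives `v - η' ∈ ‖v‖ • Q` almost everywhere. Shrinking `Q` to
the segment from `0` to `C • γ (η t)`, or to `{0}` off the boundary, produces `l` with `0 ≤ l ≤ C *
‖v‖`, hence its integrability. -/

open Filter Topology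
open scoped NNReal Pointwise

/-! ### Pushing back into the closure along an oblique direction. -/

/-- Near a boundary point, a displacement `p` from a point of `closure Ω` can be corrected by a
multiple `l ≥ C ‖p‖` of an oblique vector so as to land in `closure Ω`. -/
theorem exists_local_correction {E : Type*} [NormedAddCommGroup E] [NormedSpace ℝ E]
    {Ω : Set E} {γ : E → E} {z₀ : E} {ψ : E → ℝ} {f' : E →L[ℝ] ℝ} {S : Set E}
    (hψ : HasStrictFDerivAt ψ f' z₀) (hΩ : ∀ᶠ y in 𝓝 z₀, ψ y < 0 → y ∈ Ω)
    (hcl : ∀ᶠ y in 𝓝 z₀, y ∈ closure Ω → ψ y ≤ 0)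
    (hγ : ContinuousWithinAt γ S z₀) (hpos : 0 < f' (γ z₀)) :
    ∃ C > (0 : ℝ), ∃ r > (0 : ℝ), ∀ z ∈ S, dist z z₀ < r → ∀ y ∈ closure Ω, dist y z < r →
      ∀ (p : E) (l : ℝ), ‖p‖ < r → l < r → C * ‖p‖ ≤ l → y + p - l • γ z ∈ closure Ω := by
  obtain ⟨a, ha, haγ⟩ := exists_between hpos
  set B : ℝ := ‖γ z₀‖ + 1 with hB
  have hB0 : 0 < B := by positivity
  -- The linearization error of a push, at most `c * (l * B)`, then costs only half of the decrease
  -- `l * a`.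
  set c : ℝ := a / (2 * B) with hc
  have hc0 : 0 < c := by positivity
  have hcB : c * B = a / 2 := by rw [hc]; field_simp
  obtain ⟨s, hs, hlin⟩ := hψ.approximates_deriv_on_nhds (c := ⟨c, hc0.le⟩) (Or.inr hc0)
  have e1 : ∀ᶠ z in 𝓝[S] z₀, ‖γ z‖ < B :=
    hγ.norm.eventually (gt_mem_nhds (by linarith : ‖γ z₀‖ < B))
  have e2 : ∀ᶠ z in 𝓝[S] z₀, a < f' (γ z) :=
    (f'.continuous.continuousAt.comp_continuousWithinAt hγ).eventually (lt_mem_nhds haγ)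
  obtain ⟨R, hR, hball⟩ := Metric.eventually_nhds_iff.1 ((hΩ.and hcl).and hs)
  obtain ⟨R', hR', hball'⟩ := Metric.mem_nhdsWithin_iff.1 (e1.and e2)
  set r : ℝ := min R' (R / (4 + B)) with hr
  have hr0 : 0 < r := by positivity
  have hrR : r * (4 + B) ≤ R := by
    rw [← le_div_iff₀ (by positivity)]; exact min_le_right _ _
  -- The other half of the decrease absorbs the effect of `p`; the `+ 1` makes this strict.
  set C : ℝ := 2 * (‖f'‖ + c) / a + 1 with hC
  have hC0 : 0 < C := by positivity
  refine ⟨C, hC0, r, hr0, ?_⟩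
  intro z hzS hz y hy hyz p l hp hl hpl
  have hl0 : 0 ≤ l := le_trans (by positivity) hpl
  obtain ⟨hγB, hγa⟩ := hball' ⟨lt_of_lt_of_le hz (min_le_left _ _), hzS⟩
  -- Without a push `ψ` need not become negative, but then `p = 0` and the point stays at `y`.
  rcases hl0.eq_or_lt with rfl | hlpos
  · have : p = 0 := by
      have : ‖p‖ ≤ 0 := by
        by_contra! h
        exact absurd hpl (not_le.2 (mul_pos hC0 h))
      simpa using this
    simpa [this] using hy
  have hyz₀ : dist y z₀ < 2 * r := by linarith [dist_triangle y z z₀]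
  have hd : ‖y + p - l • γ z - y‖ ≤ ‖p‖ + l * B := by
    have : y + p - l • γ z - y = p - l • γ z := by abel
    rw [this]
    refine (norm_sub_le _ _).trans ?_
    rw [norm_smul, Real.norm_of_nonneg hl0]
    gcongr
  have hlB : l * B ≤ r * B := by gcongr
  obtain ⟨⟨-, hyψ⟩, hys⟩ := hball (show dist y z₀ < R by nlinarith)
  obtain ⟨⟨hy'Ω, -⟩, hy's⟩ := hball (show dist (y + p - l • γ z) z₀ < R by
    have := dist_triangle (y + p - l • γ z) y z₀
    rw [dist_eq_norm (y + p - l • γ z) y] at this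
    nlinarith)
  refine subset_closure (hy'Ω ?_)
  have h1 := hlin _ hy's _ hys
  have h2 : ψ (y + p - l • γ z) - ψ y - f' (y + p - l • γ z - y) ≤ c * (‖p‖ + l * B) :=
    (le_abs_self _).trans (h1.trans (mul_le_mul_of_nonneg_left hd hc0.le))
  have h3 : f' (y + p - l • γ z - y) ≤ ‖f'‖ * ‖p‖ - l * a := by
    have : f' (y + p - l • γ z - y) = f' p - l * f' (γ z) := by simp; ring
    rw [this]
    have h4 := (le_abs_self _).trans (f'.le_opNorm p)
    have h5 : l * a ≤ l * f' (γ z) := by gcongr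
    linarith
  have h6 : (‖f'‖ + c) * ‖p‖ < l * (a / 2) := by
    have h7 : (‖f'‖ + c) * ‖p‖ + a / 2 * ‖p‖ ≤ l * (a / 2) := by
      calc _ = C * ‖p‖ * (a / 2) := by rw [hC]; field_simp
        _ ≤ _ := by gcongr
    rcases (norm_nonneg p).eq_or_lt with h | h
    · rw [← h]; simp; positivity
    · have : 0 < a / 2 * ‖p‖ := by positivity
      linarith
  have := hyψ hy
  nlinarith

section Geometry

variable {n : ℕ} {Ω : Set (EuclideanSpace ℝ (Fin n))}
  {γ : EuclideanSpace ℝ (Fin n) → EuclideanSpace ℝ (Fin n)}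

theorem IsC1DefiningFunction.hasStrictFDerivAt {x : EuclideanSpace ℝ (Fin n)}
    {U : Set (EuclideanSpace ℝ (Fin n))} {ψ : EuclideanSpace ℝ (Fin n) → ℝ}
    (h : IsC1DefiningFunction Ω x U ψ) : HasStrictFDerivAt ψ (fderiv ℝ ψ x) x :=
  (h.contDiffOn.contDiffAt (h.isOpen.mem_nhds h.mem)).hasStrictFDerivAt (by simp)

theorem IsC1DefiningFunction.nonpos_of_mem_closure {x : EuclideanSpace ℝ (Fin n)}
    {U : Set (EuclideanSpace ℝ (Fin n))} {ψ : EuclideanSpace ℝ (Fin n) → ℝ}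
    (h : IsC1DefiningFunction Ω x U ψ) {y : EuclideanSpace ℝ (Fin n)} (hyU : y ∈ U)
    (hy : y ∈ closure Ω) : ψ y ≤ 0 := by
  by_contra! hpos
  have hc : ContinuousAt ψ y := h.contDiffOn.continuousOn.continuousAt (h.isOpen.mem_nhds hyU)
  obtain ⟨w, hw⟩ := mem_closure_iff_nhds.1 hy _
    (inter_mem (h.isOpen.mem_nhds hyU) (hc.eventually (lt_mem_nhds hpos)))
  exact absurd ((h.mem_iff w hw.1.1).1 hw.2) (not_lt.2 (le_of_lt hw.1.2))

theorem IsOblique.fderiv_pos (hγ : IsOblique Ω γ) {x : EuclideanSpace ℝ (Fin n)}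
    (hx : x ∈ frontier Ω) {U : Set (EuclideanSpace ℝ (Fin n))}
    {ψ : EuclideanSpace ℝ (Fin n) → ℝ} (h : IsC1DefiningFunction Ω x U ψ) :
    0 < fderiv ℝ ψ x (γ x) := by
  have h1 := hγ x hx _ ⟨hx, U, ψ, h, rfl⟩
  rw [real_inner_smul_left] at h1
  have h2 : 0 < inner ℝ (gradient ψ x) (γ x) :=
    pos_of_mul_pos_right h1 (by positivity)
  simpa [gradient] using h2

theorem IsOblique.ne_zero (hΩ : HasC1Boundary Ω) (hγ : IsOblique Ω γ)
    {x : EuclideanSpace ℝ (Fin n)} (hx : x ∈ frontier Ω) : γ x ≠ 0 := by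
  obtain ⟨U, ψ, h⟩ := hΩ x hx
  intro h0
  have := hγ.fderiv_pos hx h
  simp [h0] at this

/-- The correction of `exists_local_correction` with constants uniform along the boundary. -/
theorem exists_uniform_correction (hΩ_bdd : Bornology.IsBounded Ω)
    (hΩ_C1 : HasC1Boundary Ω) (hγ_cont : ContinuousOn γ (frontier Ω)) (hγ_obl : IsOblique Ω γ) :
    ∃ C > (0 : ℝ), ∃ r > (0 : ℝ), ∀ z ∈ frontier Ω, ∀ y ∈ closure Ω, dist y z < r →
      ∀ (p : EuclideanSpace ℝ (Fin n)) (l : ℝ), ‖p‖ < r → l < r → C * ‖p‖ ≤ l →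
        y + p - l • γ z ∈ closure Ω := by
  have hcomp : IsCompact (frontier Ω) :=
    Metric.isCompact_of_isClosed_isBounded isClosed_frontier
      (hΩ_bdd.closure.subset frontier_subset_closure)
  refine hcomp.induction_on (p := fun S => ∃ C > (0 : ℝ), ∃ r > (0 : ℝ), ∀ z ∈ S,
    ∀ y ∈ closure Ω, dist y z < r → ∀ (p : EuclideanSpace ℝ (Fin n)) (l : ℝ), ‖p‖ < r → l < r →
      C * ‖p‖ ≤ l → y + p - l • γ z ∈ closure Ω) ⟨1, one_pos, 1, one_pos, by simp⟩ ?_ ?_ ?_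
  · rintro s t hst ⟨C, hC, r, hr, h⟩
    exact ⟨C, hC, r, hr, fun z hz => h z (hst hz)⟩
  · rintro s t ⟨C, hC, r, hr, h⟩ ⟨C', hC', r', hr', h'⟩
    refine ⟨max C C', lt_max_of_lt_left hC, min r r', lt_min hr hr', ?_⟩
    rintro z (hz | hz) y hy hyz p l hp hl hpl
    · exact h z hz y hy (hyz.trans_le (min_le_left _ _)) p l (hp.trans_le (min_le_left _ _))
        (hl.trans_le (min_le_left _ _))
        ((mul_le_mul_of_nonneg_right (le_max_left _ _) (norm_nonneg p)).trans hpl)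
    · exact h' z hz y hy (hyz.trans_le (min_le_right _ _)) p l (hp.trans_le (min_le_right _ _))
        (hl.trans_le (min_le_right _ _))
        ((mul_le_mul_of_nonneg_right (le_max_right _ _) (norm_nonneg p)).trans hpl)
  · intro z₀ hz₀
    obtain ⟨U, ψ, h⟩ := hΩ_C1 z₀ hz₀
    have hU : ∀ᶠ y in 𝓝 z₀, y ∈ U := h.isOpen.mem_nhds h.mem
    obtain ⟨C, hC, r, hr, H⟩ := exists_local_correction h.hasStrictFDerivAt
      (hU.mono fun y hy => (h.mem_iff y hy).2) (hU.mono fun y hy => h.nonpos_of_mem_closure hy)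
      (hγ_cont z₀ hz₀) (hγ_obl.fderiv_pos hz₀ h)
    exact ⟨frontier Ω ∩ Metric.ball z₀ r, inter_mem_nhdsWithin _ (Metric.ball_mem_nhds _ hr),
      C, hC, r, hr, fun z hz => H z hz.1 hz.2⟩

/-- A displacement from a point of `closure Ω` shorter than the distance to the boundary does not
leave `closure Ω`. -/
theorem add_mem_closure_of_forall_frontier {E : Type*} [NormedAddCommGroup E] [NormedSpace ℝ E]
    {Ω : Set E} {y p : E} {m : ℝ} (hy : y ∈ closure Ω) (hpm : ‖p‖ ≤ m)
    (hm : ∀ z ∈ frontier Ω, m < dist y z) : y + p ∈ closure Ω := by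
  have hconv : IsPreconnected (Metric.closedBall y m) := (convex_closedBall y m).isPreconnected
  have hm0 : 0 ≤ m := (norm_nonneg p).trans hpm
  by_contra hp
  have hyi : y ∈ interior Ω := by
    by_contra hyi
    have := hm y ⟨hy, hyi⟩
    simp at this
    linarith
  obtain ⟨z, hz, hz1, hz2⟩ := hconv _ _ isOpen_interior isClosed_closure.isOpen_compl
    (fun z hz => by
      by_cases h : z ∈ interior Ω
      · exact Or.inl h
      · refine Or.inr fun hc => ?_
        have := hm z ⟨hc, h⟩
        rw [Metric.mem_closedBall, dist_comm] at hz
        linarith)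
    ⟨y, Metric.mem_closedBall_self hm0, hyi⟩
    ⟨y + p, by simpa using hpm, hp⟩
  exact hz2 (subset_closure (interior_subset hz1))

/-- One step of the Euler scheme for the Skorokhod problem. -/
theorem exists_skorokhod_step (hΩ_bdd : Bornology.IsBounded Ω)
    (hΩ_C1 : HasC1Boundary Ω) (hγ_cont : ContinuousOn γ (frontier Ω)) (hγ_obl : IsOblique Ω γ) :
    ∃ C ≥ (0 : ℝ), ∃ K ≥ (0 : ℝ), ∃ r > (0 : ℝ), ∀ y ∈ closure Ω,
      ∀ (p : EuclideanSpace ℝ (Fin n)) (m : ℝ), ‖p‖ ≤ m →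
        ∃ y' ∈ closure Ω, ‖y' - y‖ ≤ K * m ∧ (m < r →
          ∃ q, (q = 0 ∨ ∃ z ∈ frontier Ω, dist y z ≤ m ∧ q = C • γ z) ∧ y + p - y' = m • q) := by
  obtain ⟨C, hC, r, hr, H⟩ := exists_uniform_correction hΩ_bdd hΩ_C1 hγ_cont hγ_obl
  have hcomp : IsCompact (frontier Ω) :=
    Metric.isCompact_of_isClosed_isBounded isClosed_frontier
      (hΩ_bdd.closure.subset frontier_subset_closure)
  obtain ⟨G, hG⟩ := hcomp.exists_bound_of_continuousOn hγ_cont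
  refine ⟨C, hC.le, 1 + C * |G|, by positivity, min r (r / C), by positivity, ?_⟩
  intro y hy p m hpm
  have hm0 : 0 ≤ m := (norm_nonneg p).trans hpm
  by_cases hmr : m < min r (r / C)
  · have hmr1 : m < r := hmr.trans_le (min_le_left _ _)
    have hmr2 : C * m < r := by
      have := hmr.trans_le (min_le_right _ _)
      rw [lt_div_iff₀ hC] at this
      linarith
    by_cases hz : ∃ z ∈ frontier Ω, dist y z ≤ m
    · obtain ⟨z, hz, hyz⟩ := hz
      -- Pushing by `C * m` rather than `C * ‖p‖` makes the deviation exactly `m • (C • γ z)`.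
      refine ⟨y + p - (C * m) • γ z, H z hz y hy (hyz.trans_lt hmr1) p _ (hpm.trans_lt hmr1) hmr2
        (by gcongr), ?_, fun _ => ⟨C • γ z, Or.inr ⟨z, hz, hyz, rfl⟩, ?_⟩⟩
      · have : y + p - (C * m) • γ z - y = p - (C * m) • γ z := by abel
        rw [this]
        refine (norm_sub_le _ _).trans ?_
        rw [norm_smul, Real.norm_of_nonneg (by positivity)]
        have h1 : ‖γ z‖ ≤ |G| := (hG z hz).trans (le_abs_self G)
        have h2 : C * m * ‖γ z‖ ≤ C * m * |G| := by gcongr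
        linarith
      · rw [smul_smul, mul_comm m C]; abel
    · push Not at hz
      refine ⟨y + p, add_mem_closure_of_forall_frontier hy hpm hz, ?_,
        fun _ => ⟨0, Or.inl rfl, by simp⟩⟩
      have : 0 ≤ C * |G| * m := by positivity
      simpa using (by linarith : ‖p‖ ≤ (1 + C * |G|) * m)
  -- For a coarse step staying put suffices: fine grids have no such steps near a given time.
  · exact ⟨y, hy, by simp; positivity, fun h => absurd h hmr⟩

end Geometry

/-! ### Euler schemes and their limits. -/

theorem norm_sub_le_of_forall_step {E : Type*} [SeminormedAddCommGroup E] {Y : ℕ → E}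
    {W : ℕ → ℝ} {K : ℝ}
    (h : ∀ n, ‖Y (n + 1) - Y n‖ ≤ K * (W (n + 1) - W n)) {i j : ℕ} (hij : i ≤ j) :
    ‖Y j - Y i‖ ≤ K * (W j - W i) := by
  induction j, hij using Nat.le_induction with
  | base => simp
  | succ j hij ih =>
    have := norm_sub_le_norm_sub_add_norm_sub (Y (j + 1)) (Y j) (Y i)
    linarith [h j]

theorem exists_seq_of_forall_exists_step {E : Type*} {S : Set E} {R : ℕ → E → E → Prop}
    {x : E} (hx : x ∈ S)
    (h : ∀ n, ∀ y ∈ S, ∃ y' ∈ S, R n y y') :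
    ∃ Y : ℕ → E, Y 0 = x ∧ ∀ n, Y n ∈ S ∧ R n (Y n) (Y (n + 1)) := by
  choose! f hfS hfR using h
  let Y : ℕ → E := fun n => Nat.rec x (fun n y => f n y) n
  have hY : ∀ n, Y n ∈ S := fun n => by
    induction n with
    | zero => exact hx
    | succ n ih => exact hfS n _ ih
  exact ⟨Y, rfl, fun n => ⟨hY n, hfR n _ (hY n)⟩⟩

section EulerScheme

variable {E : Type*} [NormedAddCommGroup E] [NormedSpace ℝ E]

/-- Membership in multiples of a compact set passes to limits. -/
theorem IsCompact.mem_smul_of_tendsto {ι : Type*} {l : Filter ι} [l.NeBot] {Q : Set E}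
    (hQ : IsCompact Q) {x : ι → E} {w : ι → ℝ} {x₀ : E} {w₀ : ℝ} (hx : Tendsto x l (𝓝 x₀))
    (hw : Tendsto w l (𝓝 w₀)) (h : ∀ᶠ k in l, x k ∈ w k • Q) : x₀ ∈ w₀ • Q := by
  have h' : ∀ k, ∃ q, x k ∈ w k • Q → q ∈ Q ∧ w k • q = x k := fun k => by
    by_cases hk : x k ∈ w k • Q
    · obtain ⟨q, hq⟩ := hk
      exact ⟨q, fun _ => hq⟩
    · exact ⟨0, fun h => absurd h hk⟩
  choose q hq using h'
  obtain ⟨q₀, hq₀, hlim⟩ := hQ.ultrafilter_le_nhds ((Ultrafilter.of l).map q) (by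
    rw [le_principal_iff]
    exact Ultrafilter.of_le l (h.mono fun k hk => (hq k hk).1))
  refine ⟨q₀, hq₀, ?_⟩
  have h1 : Tendsto (fun k => w k • q k) (Ultrafilter.of l : Filter ι) (𝓝 (w₀ • q₀)) :=
    (hw.mono_left (Ultrafilter.of_le l)).smul hlim
  refine tendsto_nhds_unique h1 ((hx.mono_left (Ultrafilter.of_le l)).congr' ?_)
  exact Ultrafilter.of_le l (h.mono fun k hk => ((hq k hk).2).symm)

/-- Telescoping: for convex `Q` and `a, b ≥ 0`, `(a + b) • Q = a • Q + b • Q`. -/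
theorem Convex.sub_mem_smul_of_forall_step {Q : Set E} (hQ : Convex ℝ Q) (hQ0 : Q.Nonempty)
    {D : ℕ → E} {W : ℕ → ℝ} (hW : Monotone W) {i j : ℕ} (hij : i ≤ j)
    (h : ∀ n, i ≤ n → n < j → D (n + 1) - D n ∈ (W (n + 1) - W n) • Q) :
    D j - D i ∈ (W j - W i) • Q := by
  induction j, hij using Nat.le_induction with
  | base => simp [zero_smul_set hQ0]
  | succ j hij ih =>
    have h1 := ih fun n hn hnj => h n hn (by omega)
    have h2 := h j hij (by omega)
    have h3 : W (j + 1) - W i = (W j - W i) + (W (j + 1) - W j) := by ring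
    have h4 : D (j + 1) - D i = (D j - D i) + (D (j + 1) - D j) := by abel
    rw [h3, h4, hQ.add_smul (sub_nonneg.2 (hW hij)) (sub_nonneg.2 (hW j.le_succ))]
    exact add_mem_add h1 h2

theorem tendsto_floor_mul_div_add_one {t : ℝ} (ht : 0 ≤ t) :
    Tendsto (fun k : ℕ => ((⌊t * ((k : ℝ) + 1)⌋₊ : ℕ) : ℝ) / ((k : ℝ) + 1)) atTop (𝓝 t) :=
  (tendsto_nat_floor_mul_div_atTop ht).comp
    (tendsto_atTop_add_const_right _ _ tendsto_natCast_atTop_atTop)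

/-- Limits of Euler schemes. If every point `y` of the compact set `S` admits steps inside `S`
deviating from a displacement `p` with `‖p‖ ≤ m` by `m • q`, with `q = 0` or `q = g z` for some
`z ∈ Γ` at distance at most `m` from `y`, then a continuous driving path `P` dominated by `W` gives
rise to a path in `S` whose deviation from `P` is locally governed by convex sets containing the
nearby values of `g`. -/
theorem exists_euler_limit {S Γ : Set E} (hS : IsCompact S) {g : E → E} {K r : ℝ} (hK : 0 ≤ K)
    (hr : 0 < r)
    (hstep : ∀ y ∈ S, ∀ (p : E) (m : ℝ), ‖p‖ ≤ m → ∃ y' ∈ S, ‖y' - y‖ ≤ K * m ∧ (m < r →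
      ∃ q, (q = 0 ∨ ∃ z ∈ Γ, dist y z ≤ m ∧ q = g z) ∧ y + p - y' = m • q))
    {P : ℝ → E} {W : ℝ → ℝ} (hP : Continuous P) (hW : Continuous W)
    (hPW : ∀ s t, s ≤ t → ‖P t - P s‖ ≤ W t - W s) {x : E} (hx : x ∈ S) :
    ∃ η : ℝ → E, η 0 = x ∧ (∀ t, η t ∈ S) ∧
      (∀ s t, 0 ≤ s → s ≤ t → ‖η t - η s‖ ≤ K * (W t - W s)) ∧
      ∀ t₀, 0 ≤ t₀ → ∀ (Q : Set E) (ρ : ℝ), IsCompact Q → Convex ℝ Q → 0 ∈ Q → 0 < ρ →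
        (∀ z ∈ Γ, dist z (η t₀) < ρ → g z ∈ Q) →
        ∃ δ > 0, ∀ s t, 0 ≤ s → s ≤ t → |s - t₀| < δ → |t - t₀| < δ →
          (P t - η t) - (P s - η s) ∈ (W t - W s) • Q := by
  have hWmono : Monotone W := fun s t hst =>
    sub_nonneg.1 ((norm_nonneg _).trans (hPW s t hst))
  set τ : ℕ → ℕ → ℝ := fun k j => (j : ℝ) / ((k : ℝ) + 1) with hτ
  have hτmono : ∀ k, Monotone (τ k) := fun k i j hij => by
    simp only [hτ]; gcongr
  have hseq : ∀ k, ∃ Y : ℕ → E, Y 0 = x ∧ ∀ n, Y n ∈ S ∧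
      (‖Y (n + 1) - Y n‖ ≤ K * (W (τ k (n + 1)) - W (τ k n)) ∧
        (W (τ k (n + 1)) - W (τ k n) < r →
      ∃ q, (q = 0 ∨ ∃ z ∈ Γ, dist (Y n) z ≤ W (τ k (n + 1)) - W (τ k n) ∧ q = g z) ∧
        Y n + (P (τ k (n + 1)) - P (τ k n)) - Y (n + 1) =
          (W (τ k (n + 1)) - W (τ k n)) • q)) := fun k =>
    exists_seq_of_forall_exists_step (R := fun n y y' =>
      ‖y' - y‖ ≤ K * (W (τ k (n + 1)) - W (τ k n)) ∧ (W (τ k (n + 1)) - W (τ k n) < r →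
      ∃ q, (q = 0 ∨ ∃ z ∈ Γ, dist y z ≤ W (τ k (n + 1)) - W (τ k n) ∧ q = g z) ∧
        y + (P (τ k (n + 1)) - P (τ k n)) - y' = (W (τ k (n + 1)) - W (τ k n)) • q))
      hx fun n y hy => hstep y hy _ _ (hPW _ _ (hτmono k n.le_succ))
  choose Y hY0 hY using hseq
  have hYb : ∀ k i j, i ≤ j → ‖Y k j - Y k i‖ ≤ K * (W (τ k j) - W (τ k i)) :=
    fun k i j hij => norm_sub_le_of_forall_step (W := fun n => W (τ k n))
      (fun n => (hY k n).2.1) hij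
  set ι : ℝ → ℕ → ℕ := fun t k => ⌊t * ((k : ℝ) + 1)⌋₊ with hι
  have hιmono : ∀ s t k, s ≤ t → ι s k ≤ ι t k := fun s t k hst => by
    simp only [hι]; gcongr
  -- An ultrafilter yields limits at all times at once, with no extraction of subsequences.
  let 𝒰 : Ultrafilter ℕ := hyperfilter ℕ
  have h𝒰 : (𝒰 : Filter ℕ) ≤ atTop := Nat.hyperfilter_le_atTop
  have hτι : ∀ t, 0 ≤ t → Tendsto (fun k => τ k (ι t k)) 𝒰 (𝓝 t) := fun t ht =>
    (tendsto_floor_mul_div_add_one ht).mono_left h𝒰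
  have hWι : ∀ t, 0 ≤ t → Tendsto (fun k => W (τ k (ι t k))) 𝒰 (𝓝 (W t)) := fun t ht =>
    (hW.tendsto t).comp (hτι t ht)
  have hPι : ∀ t, 0 ≤ t → Tendsto (fun k => P (τ k (ι t k))) 𝒰 (𝓝 (P t)) := fun t ht =>
    (hP.tendsto t).comp (hτι t ht)
  have hlim : ∀ t, ∃ y ∈ S, Tendsto (fun k => Y k (ι t k)) 𝒰 (𝓝 y) := fun t =>
    hS.ultrafilter_le_nhds (𝒰.map fun k => Y k (ι t k)) (by
      rw [le_principal_iff]
      exact Eventually.of_forall (f := (𝒰 : Filter ℕ)) fun k => (hY k _).1)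
  choose η hηS hη using hlim
  refine ⟨η, ?_, hηS, ?_, ?_⟩
  · refine tendsto_nhds_unique (hη 0) ?_
    simp [hι, hY0]
  · intro s t hs hst
    refine le_of_tendsto_of_tendsto ((hη t).sub (hη s)).norm
      (((hWι t (hs.trans hst)).sub (hWι s hs)).const_mul K) (Eventually.of_forall fun k => ?_)
    exact hYb k _ _ (hιmono s t k hst)
  · intro t₀ ht₀ Q ρ hQ hQc hQ0 hρ hgQ
    -- If `W` stays within `θ` of `W t₀`, each step has size below `r`, and contact points lie
    -- within `ρ / 2 + ρ / 4 < ρ` of `η t₀`.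
    set θ : ℝ := min (r / 2) (ρ / (4 * (K + 1))) with hθ
    have hθ0 : 0 < θ := by positivity
    have hθr : 2 * θ ≤ r := by linarith [min_le_left (r / 2) (ρ / (4 * (K + 1)))]
    have hθρ : 2 * θ + K * (2 * θ) ≤ ρ / 2 := by
      have := min_le_right (r / 2) (ρ / (4 * (K + 1)))
      rw [← hθ, le_div_iff₀ (by positivity)] at this
      linarith
    obtain ⟨δ, hδ, hWδ⟩ := Metric.continuousAt_iff.1 hW.continuousAt θ hθ0
    refine ⟨δ, hδ, fun s t hs hst hsδ htδ => ?_⟩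
    have ht : 0 ≤ t := hs.trans hst
    have near : ∀ u, 0 ≤ u → |u - t₀| < δ → ∀ᶠ k in (𝒰 : Filter ℕ), |τ k (ι u k) - t₀| < δ :=
      fun u hu huδ => (hτι u hu).eventually
        ((continuous_abs.comp (continuous_sub_right t₀)).continuousAt.eventually (gt_mem_nhds huδ))
    refine hQ.mem_smul_of_tendsto (l := (𝒰 : Filter ℕ))
      (((hPι t ht).sub (hη t)).sub ((hPι s hs).sub (hη s))) ((hWι t ht).sub (hWι s hs)) ?_
    filter_upwards [near s hs hsδ, near t ht htδ, near t₀ ht₀ (by simpa using hδ),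
      (hη t₀).eventually (Metric.ball_mem_nhds _ (by positivity : 0 < ρ / 4))] with k ks kt k0 kη
    refine hQc.sub_mem_smul_of_forall_step ⟨0, hQ0⟩ (D := fun n => P (τ k n) - Y k n)
      (W := fun n => W (τ k n)) (hWmono.comp (hτmono k)) (hιmono s t k hst) fun n hn1 hn2 => ?_
    have bd : ∀ i, ι s k ≤ i → i ≤ ι t k → |W (τ k i) - W t₀| < θ := fun i h1 h2 => by
      have h3 := hτmono k h1
      have h4 := hτmono k h2
      refine hWδ (x := τ k i) ?_
      rw [Real.dist_eq]
      rw [abs_lt] at *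
      constructor <;> linarith
    have b1 := abs_lt.1 (bd n hn1 hn2.le)
    have b2 := abs_lt.1 (bd (n + 1) (by omega) hn2)
    have b0 := abs_lt.1 (hWδ (x := τ k (ι t₀ k)) k0)
    obtain ⟨q, hq, hqe⟩ := (hY k n).2.2 (by linarith)
    refine ⟨q, ?_, ?_⟩
    · rcases hq with rfl | ⟨z, hz, hyz, rfl⟩
      · exact hQ0
      · refine hgQ z hz ?_
        have d1 : dist (Y k n) (Y k (ι t₀ k)) ≤ K * (2 * θ) := by
          rcases le_total n (ι t₀ k) with h | h
          · rw [dist_comm, dist_eq_norm]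
            refine (hYb k _ _ h).trans (mul_le_mul_of_nonneg_left (by linarith) hK)
          · rw [dist_eq_norm]
            refine (hYb k _ _ h).trans (mul_le_mul_of_nonneg_left (by linarith) hK)
        have d2 : dist (Y k (ι t₀ k)) (η t₀) < ρ / 4 := kη
        have d3 := dist_triangle4 z (Y k n) (Y k (ι t₀ k)) (η t₀)
        rw [dist_comm] at hyz
        linarith
    · simp only
      rw [← hqe]; abel

end EulerScheme

/-! ### From increments to derivatives, and from convex sets to the reflection direction. -/

theorem AbsolutelyContinuousOnInterval.of_dist_le {X Y : Type*} [PseudoMetricSpace X]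
    [PseudoMetricSpace Y] {f : ℝ → X} {g : ℝ → Y} {a b K : ℝ}
    (hf : AbsolutelyContinuousOnInterval f a b)
    (h : ∀ s ∈ uIcc a b, ∀ t ∈ uIcc a b, dist (g s) (g t) ≤ K * dist (f s) (f t)) :
    AbsolutelyContinuousOnInterval g a b := by
  have h0 : Tendsto (fun E : ℕ × (ℕ → ℝ × ℝ) =>
      K * ∑ i ∈ Finset.range E.1, dist (f (E.2 i).1) (f (E.2 i).2))
      (totalLengthFilter ⊓ 𝓟 (disjWithin a b)) (𝓝 0) := by
    simpa using Tendsto.const_mul K hf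
  refine squeeze_zero' (Eventually.of_forall fun E => Finset.sum_nonneg fun _ _ => dist_nonneg)
    ?_ h0
  filter_upwards [mem_inf_of_right (mem_principal_self _)] with E hE
  rw [Finset.mul_sum]
  exact Finset.sum_le_sum fun i hi => h _ (hE.1 i hi).1 _ (hE.1 i hi).2

theorem mem_smul_of_forall_mem_smul_cthickening {E : Type*} [NormedAddCommGroup E]
    [NormedSpace ℝ E] {A : Set E} (hA : IsClosed A) (hA0 : A.Nonempty) {u : E} {w : ℝ}
    (h : ∀ ε > 0, u ∈ w • Metric.cthickening ε A) : u ∈ w • A := by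
  rcases eq_or_ne w 0 with rfl | hw
  · obtain ⟨q, -, hq⟩ := h 1 one_pos
    simp only [zero_smul] at hq
    rw [zero_smul_set hA0, ← hq]
    exact Set.zero_mem_zero
  · rw [mem_smul_set_iff_inv_smul_mem₀ hw, ← hA.closure_eq,
      Metric.closure_eq_iInter_cthickening]
    refine mem_iInter₂.2 fun ε hε => ?_
    rw [← mem_smul_set_iff_inv_smul_mem₀ hw]
    exact h ε hε

/-- Dividing by `t - t₀` turns the inclusion into one between slopes; right-hand slopes suffice. -/
theorem HasDerivAt.mem_smul_of_forall_sub_mem {E : Type*} [NormedAddCommGroup E]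
    [NormedSpace ℝ E] {Q : Set E} (hQ : IsCompact Q) {D : ℝ → E} {W : ℝ → ℝ} {D' : E} {W' t₀ δ : ℝ}
    (hD : HasDerivAt D D' t₀) (hW : HasDerivAt W W' t₀) (hδ : 0 < δ)
    (h : ∀ t, t₀ ≤ t → |t - t₀| < δ → D t - D t₀ ∈ (W t - W t₀) • Q) : D' ∈ W' • Q := by
  have hle : 𝓝[>] t₀ ≤ 𝓝[≠] t₀ := nhdsWithin_mono _ fun t ht => ne_of_gt ht
  refine hQ.mem_smul_of_tendsto (hD.tendsto_slope.mono_left hle) (hW.tendsto_slope.mono_left hle) ?_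
  filter_upwards [self_mem_nhdsWithin,
    mem_nhdsWithin_of_mem_nhds (Metric.ball_mem_nhds t₀ hδ)] with t ht htδ
  obtain ⟨q, hq, hqe⟩ := h t (le_of_lt ht) htδ
  refine ⟨q, hq, ?_⟩
  simp only [slope, vsub_eq_sub, smul_eq_mul] at hqe ⊢
  rw [← hqe, smul_smul]

/-- A vector in all the multiples `w • Q` of the compact convex sets `Q ∋ 0` that contain the values
`C • γ z` for `z ∈ S` near `y` vanishes if `y` is away from `S`, and is a multiple `L • γ y`
with `0 ≤ L ≤ C * w` if `y ∈ S`. -/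
theorem exists_smul_eq_of_forall_mem_smul {E : Type*} [NormedAddCommGroup E] [NormedSpace ℝ E]
    [ProperSpace E] {γ : E → E} {S : Set E} {y u : E} {C w : ℝ} (hC : 0 ≤ C) (hw : 0 ≤ w)
    (hγ : ContinuousOn γ S) (hS : IsClosed S)
    (h : ∀ (Q : Set E) (ρ : ℝ), IsCompact Q → Convex ℝ Q → 0 ∈ Q → 0 < ρ →
      (∀ z ∈ S, dist z y < ρ → C • γ z ∈ Q) → u ∈ w • Q) :
    (y ∉ S → u = 0) ∧ (y ∈ S → ∃ L, 0 ≤ L ∧ L ≤ C * w ∧ u = L • γ y) := by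
  constructor
  · intro hy
    obtain ⟨ρ, hρ, hball⟩ := Metric.mem_nhds_iff.1 (hS.isOpen_compl.mem_nhds hy)
    have := h {0} ρ isCompact_singleton (convex_singleton 0) rfl hρ
      fun z hz hzy => absurd hz (hball hzy)
    simpa using this
  · intro hy
    -- By continuity of `γ`, every closed thickening of this segment is an admissible `Q`.
    have hcomp : IsCompact (segment ℝ 0 (C • γ y)) := by
      rw [segment_eq_image]
      exact isCompact_Icc.image (by fun_prop)
    have h1 : u ∈ w • segment ℝ 0 (C • γ y) := by
      refine mem_smul_of_forall_mem_smul_cthickening hcomp.isClosed ⟨0, left_mem_segment _ _ _⟩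
        fun ε hε => ?_
      obtain ⟨ρ, hρ, hball⟩ := Metric.continuousWithinAt_iff.1 ((hγ y hy).const_smul C) ε hε
      exact h _ ρ hcomp.cthickening ((convex_segment _ _).cthickening ε)
        (Metric.self_subset_cthickening _ (left_mem_segment _ _ _)) hρ fun z hz hzy =>
          Metric.mem_cthickening_of_dist_le _ _ _ _ (right_mem_segment _ _ _) (hball hz hzy).le
    obtain ⟨q, hq, rfl⟩ := h1
    rw [segment_eq_image] at hq
    obtain ⟨θ, ⟨hθ0, hθ1⟩, rfl⟩ := hq
    refine ⟨w * (θ * C), by positivity, ?_, by simp [smul_smul]⟩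
    calc w * (θ * C) ≤ w * (1 * C) := by gcongr
      _ = C * w := by ring

theorem MemL1Loc.locallyIntegrable_indicator {F : Type*} [NormedAddCommGroup F] {f : ℝ → F}
    (hf : MemL1Loc f) : LocallyIntegrable ((Ici (0 : ℝ)).indicator f) := by
  intro t
  refine ⟨Icc (t - 1) (t + 1), Icc_mem_nhds (by linarith) (by linarith), ?_⟩
  rw [integrableOn_indicator_iff measurableSet_Ici]
  exact (hf (t + 1)).mono_set fun s hs => ⟨hs.1, hs.2.2⟩

/-! ### Construction of the solution. -/

theorem theorem4p1 {n : ℕ} (Ω : Set (EuclideanSpace ℝ (Fin n)))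
    (hΩ_open : IsOpen Ω) (hΩ_conn : IsConnected Ω) (hΩ_bdd : Bornology.IsBounded Ω)
    (hΩ_C1 : HasC1Boundary Ω)
    (γ : EuclideanSpace ℝ (Fin n) → EuclideanSpace ℝ (Fin n))
    (hγ_cont : ContinuousOn γ (frontier Ω)) (hγ_obl : IsOblique Ω γ)
    (v : ℝ → EuclideanSpace ℝ (Fin n)) (hv : MemL1Loc v)
    (x : EuclideanSpace ℝ (Fin n)) (hx : x ∈ closure Ω) :
    ∃ (η : ℝ → EuclideanSpace ℝ (Fin n)) (l : ℝ → ℝ), IsSkorokhodSolution Ω γ x v η l := by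
  obtain ⟨C, hC, K, hK, r, hr, hstep⟩ :=
    exists_skorokhod_step hΩ_bdd hΩ_C1 hγ_cont hγ_obl
  set v' : ℝ → EuclideanSpace ℝ (Fin n) := (Ici (0 : ℝ)).indicator v with hv'
  have hv'_eq : ∀ t, 0 ≤ t → v' t = v t := fun t ht => indicator_of_mem (mem_Ici.2 ht) v
  have hv'_loc : LocallyIntegrable v' := hv.locallyIntegrable_indicator
  have hv'_int : ∀ a b, IntervalIntegrable v' volume a b := fun a b =>
    intervalIntegrable_iff.2
      ((hv'_loc.integrableOn_isCompact isCompact_uIcc).mono_set uIoc_subset_uIcc)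
  have hnorm_loc : LocallyIntegrable (fun t => ‖v' t‖) :=
    hv'_loc.mono hv'_loc.aestronglyMeasurable.norm (by simp)
  have hnorm_int : ∀ a b, IntervalIntegrable (fun t => ‖v' t‖) volume a b := fun a b =>
    (hv'_int a b).norm
  set P : ℝ → EuclideanSpace ℝ (Fin n) := fun t => ∫ s in (0 : ℝ)..t, v' s with hP
  set W : ℝ → ℝ := fun t => ∫ s in (0 : ℝ)..t, ‖v' s‖ with hW
  have hPW : ∀ s t, s ≤ t → ‖P t - P s‖ ≤ W t - W s := fun s t hst => by
    simp only [hP, hW]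
    rw [intervalIntegral.integral_interval_sub_left (hv'_int _ _) (hv'_int _ _),
      intervalIntegral.integral_interval_sub_left (hnorm_int _ _) (hnorm_int _ _)]
    exact intervalIntegral.norm_integral_le_integral_norm hst
  have hWmono : Monotone W := fun s t hst =>
    sub_nonneg.1 ((norm_nonneg _).trans (hPW s t hst))
  obtain ⟨η₀, hη₀0, hη₀S, hη₀W, hη₀Q⟩ := exists_euler_limit
    (hΩ_bdd.isCompact_closure) hK hr (g := fun z => C • γ z) hstep
    (intervalIntegral.continuous_primitive hv'_int 0)
    (intervalIntegral.continuous_primitive hnorm_int 0) hPW hx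
  -- Freezing the path at negative times makes it continuous on all of `ℝ`, so the contact set `A`
  -- is closed.
  set η : ℝ → EuclideanSpace ℝ (Fin n) := fun t => η₀ (max t 0) with hη
  have hη_eq : ∀ t, 0 ≤ t → η t = η₀ t := fun t ht => by simp [hη, max_eq_left ht]
  have hηW : ∀ s t, 0 ≤ s → 0 ≤ t → dist (η s) (η t) ≤ K * dist (W s) (W t) := by
    have key : ∀ s t, 0 ≤ s → s ≤ t → dist (η s) (η t) ≤ K * dist (W s) (W t) :=
      fun s t hs hst => by
        rw [hη_eq s hs, hη_eq t (hs.trans hst), dist_comm, dist_comm (W s), dist_eq_norm,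
          Real.dist_eq, abs_of_nonneg (sub_nonneg.2 (hWmono hst))]
        exact hη₀W s t hs hst
    intro s t hs ht
    rcases le_total s t with h | h
    · exact key s t hs h
    · rw [dist_comm, dist_comm (W s)]; exact key t s ht h
  have hη_AC : MemACLoc η := fun T hT =>
    AbsolutelyContinuousOnInterval.of_dist_le
      ((hnorm_int 0 T).absolutelyContinuousOnInterval_intervalIntegral left_mem_uIcc)
      fun s hs t ht => by
        rw [uIcc_of_le hT] at hs ht
        exact hηW s t hs.1 ht.1
  have hη_cont : Continuous η := by
    have h1 : ContinuousOn η (Ici 0) := by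
      intro t ht
      have ht' : (0 : ℝ) ≤ t := ht
      have h2 := (hη_AC (t + 1) (by linarith)).continuousOn t
        (by rw [uIcc_of_le (by linarith)]; constructor <;> linarith)
      refine h2.mono_of_mem_nhdsWithin ?_
      rw [uIcc_of_le (by linarith)]
      filter_upwards [self_mem_nhdsWithin, mem_nhdsWithin_of_mem_nhds
        (Iic_mem_nhds (lt_add_one t))] with s hs1 hs2
      exact ⟨hs1, hs2⟩
    have h2 : η = fun t => η (max t 0) := by funext t; simp [hη]
    rw [h2]
    exact h1.comp_continuous (by fun_prop) fun t => mem_Ici.2 (le_max_right _ _)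
  have hη_diff : ∀ᵐ t, 0 ≤ t → DifferentiableAt ℝ η t := by
    have h1 : ∀ N : ℕ, ∀ᵐ t, t ∈ uIcc (0 : ℝ) N → DifferentiableAt ℝ η t := fun N =>
      (hη_AC N N.cast_nonneg).boundedVariationOn.ae_differentiableAt_of_mem_uIcc
    filter_upwards [ae_all_iff.2 h1] with t ht ht0
    obtain ⟨N, hN⟩ := exists_nat_ge t
    exact ht N (by rw [uIcc_of_le N.cast_nonneg]; exact ⟨ht0, hN⟩)
  have hmain : ∀ᵐ t, 0 ≤ t → DifferentiableAt ℝ η t ∧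
      (η t ∉ frontier Ω → v' t - deriv η t = 0) ∧
      (η t ∈ frontier Ω → ∃ L, 0 ≤ L ∧ L ≤ C * ‖v' t‖ ∧ v' t - deriv η t = L • γ (η t)) := by
    filter_upwards [hη_diff, LocallyIntegrable.ae_hasDerivAt_integral hv'_loc,
      LocallyIntegrable.ae_hasDerivAt_integral hnorm_loc]
      with t hd hPd hWd ht
    refine ⟨hd ht, exists_smul_eq_of_forall_mem_smul hC (norm_nonneg _) hγ_cont isClosed_frontier
      fun Q ρ hQ hQc hQ0 hρ hQγ => ?_⟩
    rw [hη_eq t ht] at hQγ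
    obtain ⟨δ, hδ, H⟩ := hη₀Q t ht Q ρ hQ hQc hQ0 hρ hQγ
    refine HasDerivAt.mem_smul_of_forall_sub_mem hQ (D := fun s => P s - η s)
      ((hPd 0).sub (hd ht).hasDerivAt) (hWd 0) hδ fun s hs hsδ => ?_
    simp only [hη_eq t ht, hη_eq s (ht.trans hs)]
    exact H t s ht hs (by simpa using hδ) hsδ
  set A : Set ℝ := η ⁻¹' frontier Ω with hA
  have hA_meas : MeasurableSet A := (isClosed_frontier.preimage hη_cont).measurableSet
  -- This formula recovers the coefficient of `γ (η t)` measurably, which choosing `L` pointwise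
  -- would not.
  set l : ℝ → ℝ := A.indicator
    (fun t => inner ℝ (v' t - deriv η t) (γ (η t)) / ‖γ (η t)‖ ^ 2) with hl
  have hl_meas : AEStronglyMeasurable l volume := by
    rw [hl, aestronglyMeasurable_indicator_iff hA_meas]
    have h1 : AEStronglyMeasurable (fun t => γ (η t)) (volume.restrict A) :=
      (hγ_cont.comp hη_cont.continuousOn fun t ht => ht).aestronglyMeasurable hA_meas
    have h2 : AEStronglyMeasurable (fun t => v' t - deriv η t) (volume.restrict A) :=
      (hv'_loc.aestronglyMeasurable.sub (stronglyMeasurable_deriv η).aestronglyMeasurable).restrict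
    exact ((h2.inner h1).aemeasurable.div (h1.norm.aemeasurable.pow_const 2)).aestronglyMeasurable
  have hl_main : ∀ᵐ t, 0 ≤ t → 0 ≤ l t ∧ l t ≤ C * ‖v' t‖ ∧
      v' t - deriv η t = l t • γ (η t) := by
    filter_upwards [hmain] with t ht ht0
    obtain ⟨-, hout, hin⟩ := ht ht0
    by_cases htA : t ∈ A
    · obtain ⟨L, hL0, hLC, hL⟩ := hin htA
      have hne : γ (η t) ≠ 0 := hγ_obl.ne_zero hΩ_C1 htA
      have : l t = L := by
        rw [hl, indicator_of_mem htA, hL, real_inner_smul_left, real_inner_self_eq_norm_sq]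
        field_simp
      rw [this]
      exact ⟨hL0, hLC, hL⟩
    · have : l t = 0 := indicator_of_notMem htA _
      rw [this, zero_smul]
      exact ⟨le_rfl, by positivity, hout htA⟩
  refine ⟨η, l, hη_AC, fun T => ?_, by simpa [hη] using hη₀0, fun t _ => hη₀S _, ?_, ?_⟩
  · have hdom : IntegrableOn (fun t => C * ‖v' t‖) (Icc 0 T) :=
      (hnorm_loc.integrableOn_isCompact isCompact_Icc).const_mul C
    refine hdom.mono' hl_meas.restrict ?_
    rw [ae_restrict_iff' measurableSet_Icc]
    filter_upwards [hl_main] with t ht htT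
    obtain ⟨h0, h1, -⟩ := ht htT.1
    rwa [Real.norm_of_nonneg h0]
  · rw [ae_restrict_iff' measurableSet_Ici]
    filter_upwards [hmain, hl_main] with t h1 h2 ht
    refine ⟨(h1 ht).1, ?_⟩
    rw [← (h2 ht).2.2, ← hv'_eq t ht]
    abel
  · rw [ae_restrict_iff' measurableSet_Ici]
    filter_upwards [hl_main] with t h2 ht
    refine ⟨(h2 ht).1, fun hmem => indicator_of_notMem ?_ _⟩
    intro hfr
    exact (disjoint_frontier_iff_isOpen.2 hΩ_open).le_bot ⟨hfr, hmem⟩
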